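/- Let $m\in\mathbb N$, let $\alpha_1,\dots,\alpha_m,\beta\in\mathbb C$ be such that $\alpha_j,\ \beta,\ \alpha_j+\beta+1\notin\{-1,-2,\dots\}$ for all $j$, and $\alpha_i-\alpha_j\notin\mathbb Z$ for $i\ne j$. For $z,w\in\mathbb C\setminus\mathbb Z$ let $\int_\Sigma h(t)\,t^z(1-t)^w\,dt$ be the integral over the closed Pochhammer contour $\Sigma$ on the Riemann surface of $t^z(1-t)^w$: it starts at $t=1/2$ with $\arg t=\arg(1-t)=0$ and encircles, in this order, $1$ anticlockwise, $0$ anticlockwise, $1$ clockwise, $0$ clockwise (say, along the circles of radius $1/2$ about $1$ and $0$), with $\arg t$ and $\arg(1-t)$ varying continuously. The complex Jacobi measure $\mu^{(\alpha,\beta)}$ is defined by $$\int h\,d\mu^{(\alpha,\beta)}=\lim_{z\to\alpha,\;w\to\beta}\ (1-e^{2\pi i z})^{-1}(1-e^{2\pi i w})^{-1}\int_\Sigma h(t)\,t^z(1-t)^w\,dt ,$$ where $z,w\notin\mathbb Z$ in the limit and $h$ is a polynomial. For a multi-index $\vec n=(n_1,\dots,n_m)$ of nonnegative integers, $|\vec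 n|=n_1+\dots+n_m$, a type II multiple orthogonal polynomial for measures $\mu_1,\dots,\mu_m$ is a polynomial $p\neq0$ of degree $\le|\vec n|$ with $\int p(t)\,t^k\,d\mu_j(t)=0$ for $0\le k\le n_j-1$, $j=1,\dots,m$. The system is called perfect if, for every $\vec n$, every such $p$ has degree exactly $|\vec n|$. Then the limits defining $\mu^{(\alpha_j,\beta)}$, $j=1,\dots,m$, exist for all polynomials $h$, and these measures form a perfect system. Moreover, for every multi-index $\vec n$, the type II multiple orthogonal polynomial is, uniquely up to a nonzero constant factor, the Jacobi–Piñeiro polynomial: there is a polynomial $P_{\vec n}^{(\vec\alpha,\beta)}$ which is a type II multiple orthogonal polynomial for $\mu^{(\alpha_1,\beta)},\dots,\mu^{(\alpha_m,\beta)}$ and $\vec n$, of which every other one is a nonzero multiple, and which satisfies the Rodrigues formula $$P_{\vec n}^{(\vec\alpha,\beta)}(t)=\frac{1}{\prod_{j=1}^m n_j!}\,(1-t)^{-\beta}\ \prod_{j=1}^m\Bigl(t^{-\alpha_j}\frac{d^{n_j}}{dt^{n_j}}\,t^{n_j+\alpha_j}\Bigr)\,(1-t)^{|\vec n|+\beta}$$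 (product of operators, the factor $j=1$ outermost; principal values of the powers) for all $t\in\mathbb C\setminus\bigl((-\infty,0]\cup[1,\infty)\bigr)$. -/

import Mathlib

open Filter Topology Polynomial

noncomputable section

namespace JacobiPineiro

/-! ## The complex Jacobi measures -/

/-- The set `{-1, -2, -3, …}` of negative integers inside `ℂ`. -/
def negInts : Set ℂ := {x | ∃ k : ℕ, x = -((k : ℂ) + 1)}

/-- Integral of `h(t) t^z (1-t)^w dt` along a path on the Riemann surface of `t^z (1-t)^w`.
The path is `γ : [a, b] → ℂ \ {0, 1}`, and its position on the Riemann surface is recorded by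
continuous branches `l₀` of `log t` and `l₁` of `log (1 - t)` along `γ`.
The orientation is from parameter `a` to parameter `b` (so it is reversed when `b < a`). -/
def branchIntegral (γ l₀ l₁ : ℝ → ℂ) (a b : ℝ) (z w : ℂ) (h : ℂ → ℂ) : ℂ :=
  ∫ s in a..b, h (γ s) * Complex.exp (z * l₀ s) * Complex.exp (w * l₁ s) * deriv γ s

/-- The circle of radius `1/2` about `0`, starting at `1/2`. -/
def circleZero (s : ℝ) : ℂ := (1 / 2 : ℂ) * Complex.exp (s * Complex.I)

/-- The circle of radius `1/2` about `1`, starting at `1/2`. -/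
def circleOne (s : ℝ) : ℂ := 1 - (1 / 2 : ℂ) * Complex.exp (s * Complex.I)

/-- The value `log (1/2) + i s` of the logarithm which varies continuously when the argument
runs over `(1/2) e^{is}`. -/
def logHalf (s : ℝ) : ℂ := (Real.log (1 / 2) : ℂ) + s * Complex.I

/-- The integral of `h(t) t^z (1-t)^w dt` over the closed (Pochhammer) contour `Σ`.
It starts at `t = 1/2` with `arg t = arg (1-t) = 0`, and consists of four circles:
about `1` anticlockwise (afterwards `arg t = 0`, `arg (1-t) = 2π`);
about `0` anticlockwise (afterwards `arg t = 2π`, `arg (1-t) = 2π`);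
about `1` clockwise (afterwards `arg t = 2π`, `arg (1-t) = 0`);
about `0` clockwise (afterwards `arg t = 0`, `arg (1-t) = 0` again).
On `circleOne` one has `Re t > 0`, and on `circleZero` one has `Re (1-t) > 0`, so there the
principal logarithm `Complex.log` is continuous. -/
def contourIntegral (z w : ℂ) (h : ℂ → ℂ) : ℂ :=
  branchIntegral circleOne (fun s => Complex.log (circleOne s)) logHalf
      0 (2 * Real.pi) z w h
  + branchIntegral circleZero logHalf
      (fun s => Complex.log (1 - circleZero s) + 2 * Real.pi * Complex.I)
      0 (2 * Real.pi) z w h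
  + branchIntegral circleOne (fun s => Complex.log (circleOne s) + 2 * Real.pi * Complex.I) logHalf
      (2 * Real.pi) 0 z w h
  + branchIntegral circleZero logHalf (fun s => Complex.log (1 - circleZero s))
      (2 * Real.pi) 0 z w h

/-- `(1 - e^{2πiz})⁻¹ (1 - e^{2πiw})⁻¹ ∫_Σ h(t) t^z (1-t)^w dt`, for `z` and `w` not integers. -/
def preJacobi (h : ℂ → ℂ) (p : ℂ × ℂ) : ℂ :=
  (1 - Complex.exp (2 * Real.pi * Complex.I * p.1))⁻¹ *
    (1 - Complex.exp (2 * Real.pi * Complex.I * p.2))⁻¹ * contourIntegral p.1 p.2 h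

/-- The filter `(z, w) → (α, β)`, where `z` and `w` stay away from the integers. -/
def approach (α β : ℂ) : Filter (ℂ × ℂ) :=
  𝓝[{p : ℂ × ℂ | (∀ k : ℤ, p.1 ≠ k) ∧ (∀ k : ℤ, p.2 ≠ k)}] (α, β)

/-- The integral `∫ h dμ^{(α,β)}` against the complex Jacobi measure:
the limit of `preJacobi h (z, w)` as `z → α`, `w → β`. -/
def jacobiIntegral (α β : ℂ) (h : ℂ → ℂ) : ℂ :=
  limUnder (approach α β) (preJacobi h)

/-! ## Multiple orthogonal polynomials of type II -/

/-- `p` is a type II (formal) multiple orthogonal polynomial with respect to the multi-index `n`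
for the system of `m` (complex) measures with integrals `L j h = ∫ h dμ_j`: it is nontrivial,
of degree `≤ |n|`, and `∫ p(t) t^k dμ_j(t) = 0` for `0 ≤ k ≤ n_j - 1` and all `j`. -/
def IsTypeII {m : ℕ} (L : Fin m → (ℂ → ℂ) → ℂ) (n : Fin m → ℕ) (p : ℂ[X]) : Prop :=
  p ≠ 0 ∧ p.natDegree ≤ ∑ j, n j ∧
    ∀ j, ∀ k < n j, L j (fun t => p.eval t * t ^ k) = 0

/-- A multi-index is normal if every solution has exact degree `|n|`. -/
def IsNormalIndex {m : ℕ} (L : Fin m → (ℂ → ℂ) → ℂ) (n : Fin m → ℕ) : Prop :=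
  ∀ p : ℂ[X], IsTypeII L n p → p.natDegree = ∑ j, n j

/-- A system of measures is perfect if every multi-index is normal. -/
def IsPerfect {m : ℕ} (L : Fin m → (ℂ → ℂ) → ℂ) : Prop :=
  ∀ n : Fin m → ℕ, IsNormalIndex L n

/-! ## The Rodrigues formula -/

/-- The operator `t^{-a} (d^k/dt^k) t^{k+a}`. -/
def rodriguesOp (a : ℂ) (k : ℕ) (f : ℂ → ℂ) : ℂ → ℂ :=
  fun t => t ^ (-a) * iteratedDeriv k (fun s => s ^ ((k : ℂ) + a) * f s) t

/-- The right-hand side of the Rodrigues formula,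
`(1/n!) (1-t)^{-β} ∏_j (t^{-α_j} (d^{n_j}/dt^{n_j}) t^{n_j+α_j}) (1-t)^{|n|+β}`,
with principal values of the powers. -/
def rodrigues {m : ℕ} (α : Fin m → ℂ) (β : ℂ) (n : Fin m → ℕ) (t : ℂ) : ℂ :=
  (∏ j, ((n j).factorial : ℂ))⁻¹ * (1 - t) ^ (-β) *
    Fin.foldr m (fun j f => rodriguesOp (α j) (n j) f)
      (fun s => (1 - s) ^ (((∑ j, n j : ℕ) : ℂ) + β)) t

end JacobiPineiro

end

namespace JacobiPineiro

/-! Everything is reduced to the Beta function. Off the integers, the normalised Pochhammer integral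
of `t^z (1-t)^w` is `Γ(z+1) Γ(w+1) / Γ(z+w+2)` (`contourIntegral_one_eq`): this is checked for
positive real parts and propagated by a recurrence that both sides satisfy. Integrals of polynomials
are then finite sums of such values (`moment`), continuous at `(α, β)` because `1/Γ` is entire, so
the limits exist.

Perfectness is a count of zeros. As a function of `x`, the moment `∫ p(t) t^x (1-t)^β dt` is a Gamma
factor times a polynomial of degree at most `deg p` (`moment_eq_mellinPolynomial`). Orthogonality
makes this polynomial vanish at the `|n|` points `α_j + k`, which are distinct since the differences
`α_i - α_j` are not integers. If `deg p < |n|`, it is zero, and then so is `p`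
(`eq_zero_of_mellinPolynomial_eq_zero`).

For the Rodrigues formula, each derivative acts on moments through integration by parts, which
yields a factor `c - x` (`moment_jacobiStep`). The resulting product of all `α_j + i - x` vanishes
at every required `x`. The polynomial is nonzero because its value at `0` is. -/

/-! ### Parametrisation of the two circles -/

theorem continuous_logHalf : Continuous logHalf := by
  unfold logHalf; fun_prop

theorem exp_logHalf (s : ℝ) : Complex.exp (logHalf s) = circleZero s := by
  rw [logHalf, Complex.exp_add, ← Complex.ofReal_exp, Real.exp_log (by norm_num), circleZero]
  push_cast; rfl

theorem hasDerivAt_logHalf (s : ℝ) : HasDerivAt logHalf Complex.I s := by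
  have h : HasDerivAt (fun s : ℝ => (s : ℂ)) 1 s := Complex.ofRealCLM.hasDerivAt
  have := (h.mul_const Complex.I).const_add (Real.log (1 / 2) : ℂ)
  rw [one_mul] at this
  exact this

theorem hasDerivAt_circleZero (s : ℝ) : HasDerivAt circleZero (Complex.I * circleZero s) s := by
  have h := (hasDerivAt_logHalf s).cexp
  rw [exp_logHalf, mul_comm] at h
  exact h.congr_of_eventuallyEq (Eventually.of_forall fun x => (exp_logHalf x).symm)

theorem deriv_circleZero : deriv circleZero = fun s => Complex.I * circleZero s :=
  funext fun s => (hasDerivAt_circleZero s).deriv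

theorem continuous_circleZero : Continuous circleZero := by
  unfold circleZero; fun_prop

theorem circleOne_eq (s : ℝ) : circleOne s = 1 - circleZero s := rfl

theorem deriv_circleOne : deriv circleOne = fun s => -(Complex.I * circleZero s) :=
  funext fun s => ((hasDerivAt_circleZero s).const_sub 1).deriv

theorem norm_circleZero (s : ℝ) : ‖circleZero s‖ = 1 / 2 := by
  rw [circleZero, norm_mul, Complex.norm_exp_ofReal_mul_I]; norm_num

theorem one_sub_mem_slitPlane {t : ℂ} (ht : ‖t‖ < 1) : 1 - t ∈ Complex.slitPlane := by
  rw [sub_eq_add_neg]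
  exact Complex.mem_slitPlane_of_norm_lt_one (by simpa using ht)

theorem circleOne_mem_slitPlane (s : ℝ) : 1 - circleZero s ∈ Complex.slitPlane :=
  one_sub_mem_slitPlane (by rw [norm_circleZero]; norm_num)

theorem continuous_log_circleOne : Continuous fun s => Complex.log (1 - circleZero s) :=
  (continuous_const.sub continuous_circleZero).clog circleOne_mem_slitPlane

theorem exp_log_circleOne (s : ℝ) :
    Complex.exp (Complex.log (1 - circleZero s)) = 1 - circleZero s :=
  Complex.exp_log (Complex.slitPlane_ne_zero (circleOne_mem_slitPlane s))

/-! ### Reduction of the Pochhammer integral to loops about `0` -/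

/-- Since `exp (l₀ s) = γ s`, a power `t^i` can be absorbed into the exponent `z`. -/
theorem branchIntegral_polynomial {γ l₀ l₁ : ℝ → ℂ} (hγ : Continuous (deriv γ))
    (h₀ : Continuous l₀) (h₁ : Continuous l₁) (hexp : ∀ s, Complex.exp (l₀ s) = γ s)
    (a b : ℝ) (z w : ℂ) (p : ℂ[X]) :
    branchIntegral γ l₀ l₁ a b z w (fun t => p.eval t) =
      ∑ i ∈ Finset.range (p.natDegree + 1),
        p.coeff i * branchIntegral γ l₀ l₁ a b (z + i) w (fun _ => 1) := by
  unfold branchIntegral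
  simp_rw [← intervalIntegral.integral_const_mul]
  rw [← intervalIntegral.integral_finsetSum]
  · refine intervalIntegral.integral_congr fun s _ => ?_
    simp only [eval_eq_sum_range, Finset.sum_mul]
    refine Finset.sum_congr rfl fun i _ => ?_
    rw [add_mul z, Complex.exp_add, Complex.exp_nat_mul, hexp]
    ring
  · intro i _
    apply Continuous.intervalIntegrable
    fun_prop

theorem contourIntegral_polynomial (z w : ℂ) (p : ℂ[X]) :
    contourIntegral z w (fun t => p.eval t) =
      ∑ i ∈ Finset.range (p.natDegree + 1),
        p.coeff i * contourIntegral (z + i) w (fun _ => 1) := by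
  have hc := continuous_circleZero
  have hl := continuous_log_circleOne
  have hl' : Continuous fun s => Complex.log (1 - circleZero s) + 2 * Real.pi * Complex.I :=
    hl.add continuous_const
  have h0 : Continuous (deriv circleZero) := by rw [deriv_circleZero]; fun_prop
  have h1 : Continuous (deriv circleOne) := by rw [deriv_circleOne]; fun_prop
  have hlh := continuous_logHalf
  unfold contourIntegral
  simp only [circleOne_eq]
  rw [branchIntegral_polynomial h1 hl hlh exp_log_circleOne,
    branchIntegral_polynomial h0 hlh hl' exp_logHalf,
    branchIntegral_polynomial h1 hl' hlh
      (fun s => by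
        show Complex.exp (Complex.log (1 - circleZero s) + _) = _
        rw [Complex.exp_add, Complex.exp_two_pi_mul_I, mul_one]
        exact exp_log_circleOne s),
    branchIntegral_polynomial h0 hlh hl exp_logHalf,
    ← Finset.sum_add_distrib, ← Finset.sum_add_distrib, ← Finset.sum_add_distrib]
  exact Finset.sum_congr rfl fun i _ => by ring

/-- The integral of `t^z (1-t)^w` along the circle of radius `1/2` about `0`. -/
noncomputable def zeroLoop (z w : ℂ) : ℂ :=
  ∫ s in (0 : ℝ)..2 * Real.pi, Complex.exp (z * logHalf s) *
    Complex.exp (w * Complex.log (1 - circleZero s)) * (Complex.I * circleZero s)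

/-- The reflection `t ↦ 1 - t` turns the circle about `1` into the one about `0` with the exponents
exchanged. Each circle is run twice in opposite directions, on sheets whose integrands differ by
`e^{2πiz}` or `e^{2πiw}`. -/
theorem contourIntegral_one (z w : ℂ) :
    contourIntegral z w (fun _ => 1) =
      (Complex.exp (2 * Real.pi * Complex.I * z) - 1) * zeroLoop w z +
      (Complex.exp (2 * Real.pi * Complex.I * w) - 1) * zeroLoop z w := by
  have e1 : branchIntegral circleOne (fun s => Complex.log (circleOne s)) logHalf
      0 (2 * Real.pi) z w (fun _ => 1) = - zeroLoop w z := by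
    rw [branchIntegral, zeroLoop, ← intervalIntegral.integral_neg]
    refine intervalIntegral.integral_congr fun s _ => ?_
    simp only [deriv_circleOne, circleOne_eq]; ring
  have e2 : branchIntegral circleZero logHalf
      (fun s => Complex.log (1 - circleZero s) + 2 * Real.pi * Complex.I)
      0 (2 * Real.pi) z w (fun _ => 1) =
      Complex.exp (2 * Real.pi * Complex.I * w) * zeroLoop z w := by
    rw [branchIntegral, zeroLoop, ← intervalIntegral.integral_const_mul]
    refine intervalIntegral.integral_congr fun s _ => ?_
    simp only [deriv_circleZero, mul_add, Complex.exp_add]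
    rw [mul_comm w (2 * _ * _)]; ring
  have e3 : branchIntegral circleOne
      (fun s => Complex.log (circleOne s) + 2 * Real.pi * Complex.I) logHalf
      (2 * Real.pi) 0 z w (fun _ => 1) =
      Complex.exp (2 * Real.pi * Complex.I * z) * zeroLoop w z := by
    rw [branchIntegral, zeroLoop, intervalIntegral.integral_symm, ← intervalIntegral.integral_neg,
      ← intervalIntegral.integral_const_mul]
    refine intervalIntegral.integral_congr fun s _ => ?_
    simp only [deriv_circleOne, circleOne_eq, mul_add, Complex.exp_add]
    rw [mul_comm z (2 * _ * _)]; ring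
  have e4 : branchIntegral circleZero logHalf (fun s => Complex.log (1 - circleZero s))
      (2 * Real.pi) 0 z w (fun _ => 1) = - zeroLoop z w := by
    rw [branchIntegral, zeroLoop, intervalIntegral.integral_symm]
    simp only [deriv_circleZero, one_mul]
  rw [contourIntegral, e1, e2, e3, e4]; ring

/-! ### Collapse of the loop onto the segment `[0, 1/2]` -/

theorem integral_exp_logHalf {u : ℂ} (hu : u + 1 ≠ 0) :
    ∫ s in (0 : ℝ)..2 * Real.pi, Complex.exp (u * logHalf s) * (Complex.I * circleZero s) =
      (Complex.exp (2 * Real.pi * Complex.I * u) - 1) * ((1 / 2 : ℂ) ^ (u + 1) / (u + 1)) := by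
  have hd (s : ℝ) : HasDerivAt (fun s => Complex.exp ((u + 1) * logHalf s) / (u + 1))
      (Complex.exp (u * logHalf s) * (Complex.I * circleZero s)) s := by
    convert! (((hasDerivAt_logHalf s).const_mul (u + 1)).cexp).div_const (u + 1) using 1
    rw [add_mul, one_mul, Complex.exp_add, exp_logHalf]
    field_simp
  rw [intervalIntegral.integral_eq_sub_of_hasDerivAt (fun s _ => hd s)]
  · have e : logHalf (2 * Real.pi) = logHalf 0 + 2 * Real.pi * Complex.I := by simp [logHalf]
    have e0 : Complex.exp ((u + 1) * logHalf 0) = (1 / 2 : ℂ) ^ (u + 1) := by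
      rw [Complex.cpow_def_of_ne_zero (by norm_num), mul_comm, logHalf, Complex.ofReal_log (by norm_num)]
      simp
    rw [e, mul_add, Complex.exp_add, e0,
      show (u + 1) * (2 * Real.pi * Complex.I) = 2 * Real.pi * Complex.I * u + 2 * Real.pi * Complex.I
        by ring, Complex.exp_add, Complex.exp_two_pi_mul_I]
    ring
  · apply Continuous.intervalIntegrable
    have := continuous_logHalf
    have := continuous_circleZero
    fun_prop

/-- Absolute convergence at `1/2`, the radius of the loop, supplies the dominating series for
termwise integration. -/
theorem exists_hasSum_one_sub_cpow (w : ℂ) : ∃ c : ℕ → ℂ,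
    Summable (fun n => ‖c n‖ * (1 / 2 : ℝ) ^ n) ∧
    ∀ t : ℂ, ‖t‖ < 1 → HasSum (fun n => c n * t ^ n) ((1 - t) ^ w) := by
  refine ⟨fun n => Ring.choose w n * (-1) ^ n, ?_, fun t ht => ?_⟩
  · have h : ((1 / 2 : NNReal) : ENNReal) < (binomialSeries ℂ w).radius := by
      refine lt_of_lt_of_le ?_ binomialSeries_radius_ge_one
      rw [← ENNReal.coe_one, ENNReal.coe_lt_coe]
      exact NNReal.half_lt_self one_ne_zero
    have := (binomialSeries ℂ w).summable_norm_mul_pow h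
    simpa [binomialSeries, FormalMultilinearSeries.ofScalars_norm] using this
  · have := (Complex.one_add_cpow_hasFPowerSeriesOnBall_zero (a := w)).hasSum (y := -t)
      (by simpa [← ENNReal.ofReal_one, Metric.eball_ofReal] using ht)
    rw [zero_add, ← sub_eq_add_neg] at this
    convert! this using 2 with n
    rw [binomialSeries_apply]
    simp only [List.ofFn_const, List.prod_replicate, smul_eq_mul]
    rw [neg_pow t]; ring

theorem two_pi_exp_add_nat (z : ℂ) (n : ℕ) :
    Complex.exp (2 * Real.pi * Complex.I * (z + n)) = Complex.exp (2 * Real.pi * Complex.I * z) := by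
  rw [mul_add, Complex.exp_add, mul_comm _ (n : ℂ), Complex.exp_nat_mul_two_pi_mul_I, mul_one]

/-- No contour is deformed: `(1-t)^w` is expanded in its binomial series on both sides, and for each
`t^(z+n)` the loop integral is `e^{2πiz} - 1` times the segment integral, because the primitive is
multiplied by `e^{2πiz}` around the loop and vanishes at `0`. -/
theorem zeroLoop_eq_integral {z : ℂ} (hz : 0 < z.re) (w : ℂ) :
    zeroLoop z w = (Complex.exp (2 * Real.pi * Complex.I * z) - 1) *
      ∫ t in (0 : ℝ)..1 / 2, (t : ℂ) ^ z * (1 - (t : ℂ)) ^ w := by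
  obtain ⟨c, hc, hs⟩ := exists_hasSum_one_sub_cpow w
  have hre (n : ℕ) : 0 < (z + n).re := by
    simp only [Complex.add_re, Complex.natCast_re]; positivity
  have hne (n : ℕ) : z + n + 1 ≠ 0 := by
    intro h
    have := congrArg Complex.re h
    have := hre n
    simp at *; linarith
  set E := Complex.exp (2 * Real.pi * Complex.I * z) - 1 with hE
  have H1 : HasSum (fun n : ℕ => c n * (E * ((1 / 2 : ℂ) ^ (z + n + 1) / (z + n + 1))))
      (zeroLoop z w) := by
    have hb : ∃ C : ℝ, ∀ s ∈ Set.uIcc (0 : ℝ) (2 * Real.pi), ‖Complex.exp (z * logHalf s)‖ ≤ C :=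
      isCompact_uIcc.exists_bound_of_continuousOn
        (Continuous.continuousOn (by have := continuous_logHalf; fun_prop))
    obtain ⟨C, hC⟩ := hb
    have := continuous_logHalf
    have := continuous_circleZero
    have key := intervalIntegral.hasSum_integral_of_dominated_convergence
      (μ := MeasureTheory.volume) (a := 0) (b := 2 * Real.pi)
      (F := fun (n : ℕ) s => c n * (Complex.exp ((z + n) * logHalf s) * (Complex.I * circleZero s)))
      (f := fun s => Complex.exp (z * logHalf s) *
        Complex.exp (w * Complex.log (1 - circleZero s)) * (Complex.I * circleZero s))
      (fun n _ => C * (‖c n‖ * (1 / 2) ^ n))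
      (fun n => (Continuous.aestronglyMeasurable (by fun_prop)))
      (fun n => MeasureTheory.ae_of_all _ fun s hs' => by
        have h1 := hC s (Set.uIoc_subset_uIcc hs')
        rw [add_mul, Complex.exp_add, Complex.exp_nat_mul, exp_logHalf]
        simp only [norm_mul, norm_pow, norm_circleZero, Complex.norm_I]
        have h2 : 0 ≤ ‖c n‖ * (1 / 2 : ℝ) ^ n := by positivity
        have h3 := mul_le_mul_of_nonneg_right h1 h2
        have h4 : 0 ≤ ‖Complex.exp (z * logHalf s)‖ * (‖c n‖ * (1 / 2 : ℝ) ^ n) := by positivity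
        linarith)
      (MeasureTheory.ae_of_all _ fun s _ => hc.mul_left C)
      intervalIntegrable_const
      (MeasureTheory.ae_of_all _ fun s _ => by
        have h1 := hs (circleZero s) (by rw [norm_circleZero]; norm_num)
        have h2 := h1.mul_left (Complex.exp (z * logHalf s) * (Complex.I * circleZero s))
        rw [Complex.cpow_def_of_ne_zero (Complex.slitPlane_ne_zero (circleOne_mem_slitPlane s)),
          mul_comm (Complex.log _) w] at h2
        convert! h2 using 1
        · ext n
          rw [add_mul, Complex.exp_add, Complex.exp_nat_mul, exp_logHalf]; ring
        · ring)
    convert! key using 2 with n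
    rw [intervalIntegral.integral_const_mul, integral_exp_logHalf (hne n), two_pi_exp_add_nat]
  have H2 : HasSum (fun n : ℕ => c n * ((1 / 2 : ℂ) ^ (z + n + 1) / (z + n + 1)))
      (∫ t in (0 : ℝ)..1 / 2, (t : ℂ) ^ z * (1 - (t : ℂ)) ^ w) := by
    have key := intervalIntegral.hasSum_integral_of_dominated_convergence
      (μ := MeasureTheory.volume) (a := 0) (b := 1 / 2)
      (F := fun (n : ℕ) (t : ℝ) => c n * (t : ℂ) ^ (z + n))
      (f := fun t : ℝ => (t : ℂ) ^ z * (1 - (t : ℂ)) ^ w)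
      (fun n _ => ‖c n‖ * (1 / 2) ^ n)
      (fun n => by
        refine (Continuous.aestronglyMeasurable ?_)
        exact continuous_const.mul (Complex.continuous_ofReal_cpow_const (hre n)))
      (fun n => MeasureTheory.ae_of_all _ fun s hs' => by
        rw [Set.uIoc_of_le (by norm_num)] at hs'
        rw [norm_mul, Complex.norm_cpow_eq_rpow_re_of_pos hs'.1]
        refine mul_le_mul_of_nonneg_left ?_ (norm_nonneg _)
        have h1 : (n : ℝ) ≤ (z + n).re := by simp [hz.le]
        calc s ^ (z + n).re ≤ s ^ (n : ℝ) :=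
              Real.rpow_le_rpow_of_exponent_ge hs'.1 (hs'.2.trans (by norm_num)) h1
          _ = s ^ n := Real.rpow_natCast _ _
          _ ≤ (1 / 2) ^ n := pow_le_pow_left₀ hs'.1.le hs'.2 n)
      (MeasureTheory.ae_of_all _ fun s _ => hc)
      intervalIntegrable_const
      (MeasureTheory.ae_of_all _ fun s hs' => by
        rw [Set.uIoc_of_le (by norm_num)] at hs'
        have h1 := hs (s : ℂ) (by
          rw [Complex.norm_real, Real.norm_of_nonneg hs'.1.le]; linarith [hs'.2])
        have h2 := h1.mul_left ((s : ℂ) ^ z)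
        convert! h2 using 1
        ext n
        rw [Complex.cpow_add _ _ (by exact_mod_cast hs'.1.ne'), Complex.cpow_natCast]; ring)
    convert! key using 2 with n
    rw [intervalIntegral.integral_const_mul, integral_cpow (Or.inl (by linarith [hre n]))]
    have : ((0 : ℝ) : ℂ) ^ (z + n + 1) = 0 := by
      rw [Complex.ofReal_zero, Complex.zero_cpow (hne n)]
    rw [this, sub_zero]
    norm_num
  refine H1.unique ?_
  convert! H2.mul_left E using 2 with n
  ring

/-! ### Recurrence for the contour integral -/

theorem zeroLoop_add_one (z w : ℂ) : zeroLoop z w = zeroLoop (z + 1) w + zeroLoop z (w + 1) := by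
  have := continuous_logHalf
  have := continuous_circleZero
  have := continuous_log_circleOne
  unfold zeroLoop
  rw [← intervalIntegral.integral_add (Continuous.intervalIntegrable (by fun_prop) _ _)
    (Continuous.intervalIntegrable (by fun_prop) _ _)]
  refine intervalIntegral.integral_congr fun s _ => ?_
  simp only [add_mul, one_mul, Complex.exp_add, exp_logHalf, exp_log_circleOne]
  ring

/-- The integrand on the left is the derivative of `t^(z+1) (1-t)^(w+1)`; the right side is its
increment around the loop, with both ends at `t = 1/2`. -/
theorem zeroLoop_integration_by_parts (z w : ℂ) :
    (z + 1) * zeroLoop z (w + 1) - (w + 1) * zeroLoop (z + 1) w =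
      (Complex.exp (2 * Real.pi * Complex.I * z) - 1) *
        Complex.exp ((z + w + 2) * Complex.log (1 / 2)) := by
  have := continuous_logHalf
  have := continuous_circleZero
  have := continuous_log_circleOne
  have hd (s : ℝ) : HasDerivAt (fun s => Complex.exp ((z + 1) * logHalf s) *
        Complex.exp ((w + 1) * Complex.log (1 - circleZero s)))
      ((z + 1) * (Complex.exp (z * logHalf s) *
        Complex.exp ((w + 1) * Complex.log (1 - circleZero s)) * (Complex.I * circleZero s)) -
      (w + 1) * (Complex.exp ((z + 1) * logHalf s) *
        Complex.exp (w * Complex.log (1 - circleZero s)) * (Complex.I * circleZero s))) s := by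
    have h1 := ((hasDerivAt_logHalf s).const_mul (z + 1)).cexp
    have h2 := ((((hasDerivAt_circleZero s).const_sub 1).clog_real
      (circleOne_mem_slitPlane s)).const_mul (w + 1)).cexp
    convert! h1.mul h2 using 1
    have hne := Complex.slitPlane_ne_zero (circleOne_mem_slitPlane s)
    simp only [add_mul, one_mul, Complex.exp_add, exp_logHalf, exp_log_circleOne]
    field_simp
    ring
  unfold zeroLoop
  rw [← intervalIntegral.integral_const_mul, ← intervalIntegral.integral_const_mul,
    ← intervalIntegral.integral_sub (Continuous.intervalIntegrable (by fun_prop) _ _)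
      (Continuous.intervalIntegrable (by fun_prop) _ _),
    intervalIntegral.integral_eq_sub_of_hasDerivAt (fun s _ => hd s)
      (Continuous.intervalIntegrable (by fun_prop) _ _)]
  have e : logHalf (2 * Real.pi) = logHalf 0 + 2 * Real.pi * Complex.I := by simp [logHalf]
  have e0 : logHalf 0 = Complex.log (1 / 2) := by
    rw [logHalf, Complex.ofReal_log (by norm_num)]; simp
  have c0 : 1 - circleZero 0 = 1 / 2 := by simp [circleZero]; norm_num
  have c1 : 1 - circleZero (2 * Real.pi) = 1 / 2 := by
    simp [circleZero, Complex.exp_two_pi_mul_I]; norm_num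
  rw [c0, c1, e, e0, show (z + 1) * (Complex.log (1 / 2) + 2 * Real.pi * Complex.I) =
      2 * Real.pi * Complex.I * z + 2 * Real.pi * Complex.I + (z + 1) * Complex.log (1 / 2) by ring,
    show (z + w + 2) * Complex.log (1 / 2) =
      (z + 1) * Complex.log (1 / 2) + (w + 1) * Complex.log (1 / 2) by ring,
    Complex.exp_add, Complex.exp_add, Complex.exp_add, Complex.exp_two_pi_mul_I]
  ring

theorem two_pi_exp_add_one (z : ℂ) :
    Complex.exp (2 * Real.pi * Complex.I * (z + 1)) = Complex.exp (2 * Real.pi * Complex.I * z) := by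
  simpa using two_pi_exp_add_nat z 1

theorem contourIntegral_one_symm (z w : ℂ) :
    contourIntegral z w (fun _ => 1) = contourIntegral w z (fun _ => 1) := by
  rw [contourIntegral_one, contourIntegral_one, add_comm]

/-- The boundary terms of the two loops are symmetric in `z, w` up to their monodromy factors, so
they cancel over the closed contour. -/
theorem contourIntegral_one_recurrence (z w : ℂ) :
    (z + 1) * contourIntegral z w (fun _ => 1) =
      (z + w + 2) * contourIntegral (z + 1) w (fun _ => 1) := by
  have h1 := zeroLoop_add_one z w
  have h2 := zeroLoop_add_one w z
  have h3 := zeroLoop_integration_by_parts z w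
  have h4 := zeroLoop_integration_by_parts w z
  rw [show w + z + 2 = z + w + 2 by ring] at h4
  simp only [contourIntegral_one, two_pi_exp_add_one]
  rw [h1, h2]
  linear_combination (Complex.exp (2 * Real.pi * Complex.I * w) - 1) * h3 -
    (Complex.exp (2 * Real.pi * Complex.I * z) - 1) * h4

/-! ### Identification with the Beta function -/

/-- The value `Γ(x+1) Γ(g+1) / Γ(x+g+2)` of `∫ t^x (1-t)^g dt` over `[0, 1]`. -/
noncomputable def betaMoment (x g : ℂ) : ℂ :=
  Complex.Gamma (x + 1) * Complex.Gamma (g + 1) * (Complex.Gamma (x + g + 2))⁻¹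

theorem betaMoment_symm (x g : ℂ) : betaMoment x g = betaMoment g x := by
  rw [betaMoment, betaMoment, add_comm x g]; ring

theorem betaMoment_recurrence {x : ℂ} (hx : x + 1 ≠ 0) (g : ℂ) :
    (x + 1) * betaMoment x g = (x + g + 2) * betaMoment (x + 1) g := by
  have h1 := Complex.Gamma_add_one (x + 1) hx
  have h2 := Complex.one_div_Gamma_eq_self_mul_one_div_Gamma_add_one (x + g + 2)
  rw [betaMoment, betaMoment, h1, h2, show x + 1 + g + 2 = x + g + 2 + 1 by ring]
  ring

theorem betaMoment_add_one {x g : ℂ} (hx : x + 1 ≠ 0) (hg : g + 1 ≠ 0) :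
    betaMoment x g = betaMoment (x + 1) g + betaMoment x (g + 1) := by
  have h1 := Complex.Gamma_add_one (x + 1) hx
  have h2 := Complex.one_div_Gamma_eq_self_mul_one_div_Gamma_add_one (x + g + 2)
  have h3 := Complex.Gamma_add_one (g + 1) hg
  rw [betaMoment, betaMoment, betaMoment, h1, h2, h3,
    show x + 1 + g + 2 = x + g + 2 + 1 by ring, show x + (g + 1) + 2 = x + g + 2 + 1 by ring]
  ring

theorem betaMoment_eq_integral {z w : ℂ} (hz : 0 < z.re) (hw : 0 < w.re) :
    betaMoment z w = (∫ t in (0 : ℝ)..1 / 2, (t : ℂ) ^ z * (1 - (t : ℂ)) ^ w) +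
      ∫ t in (0 : ℝ)..1 / 2, (t : ℂ) ^ w * (1 - (t : ℂ)) ^ z := by
  have hz' : 0 < (z + 1).re := by simp; linarith
  have hw' : 0 < (w + 1).re := by simp; linarith
  have hb := Complex.betaIntegral_eq_Gamma_mul_div (z + 1) (w + 1) hz' hw'
  have hi := Complex.betaIntegral_convergent hz' hw'
  rw [Complex.betaIntegral] at hb
  simp only [add_sub_cancel_right] at hb hi
  rw [betaMoment, show z + w + 2 = z + 1 + (w + 1) by ring, ← div_eq_mul_inv, ← hb,
    ← intervalIntegral.integral_add_adjacent_intervals (b := 1 / 2)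
      (hi.mono_set (by
        rw [Set.uIcc_of_le (by norm_num), Set.uIcc_of_le (by norm_num)]
        exact Set.Icc_subset_Icc le_rfl (by norm_num)))
      (hi.mono_set (by
        rw [Set.uIcc_of_le (by norm_num), Set.uIcc_of_le (by norm_num)]
        exact Set.Icc_subset_Icc (by norm_num) le_rfl))]
  congr 1
  have := intervalIntegral.integral_comp_sub_left (a := 0) (b := 1 / 2)
    (fun t : ℝ => (t : ℂ) ^ z * (1 - (t : ℂ)) ^ w) 1
  rw [show (1 : ℝ) - 1 / 2 = 1 / 2 by norm_num, sub_zero] at this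
  rw [← this]
  refine intervalIntegral.integral_congr fun t _ => ?_
  simp only [Complex.ofReal_sub, Complex.ofReal_one, sub_sub_cancel]
  ring

theorem contourIntegral_one_of_re_pos {z w : ℂ} (hz : 0 < z.re) (hw : 0 < w.re) :
    contourIntegral z w (fun _ => 1) = (1 - Complex.exp (2 * Real.pi * Complex.I * z)) *
      (1 - Complex.exp (2 * Real.pi * Complex.I * w)) * betaMoment z w := by
  rw [contourIntegral_one, zeroLoop_eq_integral hz, zeroLoop_eq_integral hw,
    betaMoment_eq_integral hz hw]
  ring

theorem add_one_ne_intCast {z : ℂ} (hz : ∀ k : ℤ, z ≠ k) (k : ℤ) : z + 1 ≠ k := fun h =>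
  hz (k - 1) (by push_cast; linear_combination h)

theorem contourIntegral_one_of_shift {z w : ℂ} (hz : ∀ k : ℤ, z ≠ k)
    (h : contourIntegral (z + 1) w (fun _ => 1) =
      (1 - Complex.exp (2 * Real.pi * Complex.I * (z + 1))) *
        (1 - Complex.exp (2 * Real.pi * Complex.I * w)) * betaMoment (z + 1) w) :
    contourIntegral z w (fun _ => 1) = (1 - Complex.exp (2 * Real.pi * Complex.I * z)) *
      (1 - Complex.exp (2 * Real.pi * Complex.I * w)) * betaMoment z w := by
  have hz1 : z + 1 ≠ 0 := by simpa using add_one_ne_intCast hz 0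
  have h1 := contourIntegral_one_recurrence z w
  have h2 := betaMoment_recurrence hz1 w
  rw [two_pi_exp_add_one] at h
  apply mul_left_cancel₀ hz1
  rw [h1, h]
  linear_combination -(1 - Complex.exp (2 * Real.pi * Complex.I * z)) *
      (1 - Complex.exp (2 * Real.pi * Complex.I * w)) * h2

theorem contourIntegral_one_eq {z w : ℂ} (hz : ∀ k : ℤ, z ≠ k) (hw : ∀ k : ℤ, w ≠ k) :
    contourIntegral z w (fun _ => 1) = (1 - Complex.exp (2 * Real.pi * Complex.I * z)) *
      (1 - Complex.exp (2 * Real.pi * Complex.I * w)) * betaMoment z w := by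
  -- Continuation in one variable at a time: `key` lowers `Re z` by unit steps while `Re w > 0`;
  -- `key2` then lowers `Re w` for arbitrary non-integer `z`, using symmetry.
  have key (n : ℕ) : ∀ {z w : ℂ}, (∀ k : ℤ, z ≠ k) → 0 < z.re + n → 0 < w.re →
      contourIntegral z w (fun _ => 1) = (1 - Complex.exp (2 * Real.pi * Complex.I * z)) *
      (1 - Complex.exp (2 * Real.pi * Complex.I * w)) * betaMoment z w := by
    induction n with
    | zero => intro z w _ h1 h2; exact contourIntegral_one_of_re_pos (by simpa using h1) h2
    | succ n ih =>
      intro z w hz h1 h2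
      refine contourIntegral_one_of_shift hz (ih (add_one_ne_intCast hz) ?_ h2)
      simp only [Complex.add_re, Complex.one_re]; push_cast at h1; linarith
  have key2 (n : ℕ) : ∀ {w : ℂ}, (∀ k : ℤ, w ≠ k) → 0 < w.re + n →
      contourIntegral w z (fun _ => 1) = (1 - Complex.exp (2 * Real.pi * Complex.I * w)) *
      (1 - Complex.exp (2 * Real.pi * Complex.I * z)) * betaMoment w z := by
    induction n with
    | zero =>
      intro w _ h1
      obtain ⟨n, hn⟩ := exists_nat_gt (-z.re)
      rw [contourIntegral_one_symm, key n hz (by linarith) (by simpa using h1), betaMoment_symm z w]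
      ring
    | succ n ih =>
      intro w hw h1
      refine contourIntegral_one_of_shift hw (ih (add_one_ne_intCast hw) ?_)
      simp only [Complex.add_re, Complex.one_re]; push_cast at h1; linarith
  obtain ⟨n, hn⟩ := exists_nat_gt (-w.re)
  rw [contourIntegral_one_symm, key2 n hw (by linarith), betaMoment_symm z w]
  ring

theorem two_pi_exp_ne_one {z : ℂ} (hz : ∀ k : ℤ, z ≠ k) :
    1 - Complex.exp (2 * Real.pi * Complex.I * z) ≠ 0 := by
  intro h
  obtain ⟨n, hn⟩ := Complex.exp_eq_one_iff.1 (sub_eq_zero.1 h).symm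
  refine hz n (mul_left_cancel₀ Complex.two_pi_I_ne_zero ?_)
  rw [hn]; ring

/-! ### Moments of polynomials and existence of the limits -/

/-- The moment functional `∫ p(t) t^x (1-t)^g dt` on polynomials. -/
noncomputable def moment (x g : ℂ) (p : ℂ[X]) : ℂ :=
  ∑ i ∈ Finset.range (p.natDegree + 1), p.coeff i * betaMoment (x + i) g

theorem preJacobi_polynomial (p : ℂ[X]) {z w : ℂ} (hz : ∀ k : ℤ, z ≠ k) (hw : ∀ k : ℤ, w ≠ k) :
    preJacobi (fun t => p.eval t) (z, w) = moment z w p := by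
  rw [preJacobi, contourIntegral_polynomial, moment, Finset.mul_sum]
  refine Finset.sum_congr rfl fun i _ => ?_
  have hzi : ∀ k : ℤ, z + i ≠ k := fun k h => hz (k - i) (by push_cast; linear_combination h)
  rw [contourIntegral_one_eq hzi hw, two_pi_exp_add_nat]
  have h1 := two_pi_exp_ne_one hz
  have h2 := two_pi_exp_ne_one hw
  field_simp

theorem add_natCast_notMem_negInts {x : ℂ} (hx : x ∉ negInts) (i : ℕ) : x + i ∉ negInts := by
  rintro ⟨k, hk⟩
  exact hx ⟨k + i, by push_cast; linear_combination hk⟩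

theorem add_one_ne_neg_natCast {x : ℂ} (hx : x ∉ negInts) (k : ℕ) : x + 1 ≠ -k := fun h =>
  hx ⟨k, by linear_combination h⟩

/-- As `1/Γ` is entire, poles can come only from the two numerator factors, so `x + g` needs no
restriction. -/
theorem continuousAt_betaMoment {x g : ℂ} (hx : x ∉ negInts) (hg : g ∉ negInts) :
    ContinuousAt (fun p : ℂ × ℂ => betaMoment p.1 p.2) (x, g) := by
  unfold betaMoment
  have h1 : ContinuousAt Complex.Gamma (x + 1) :=
    (Complex.differentiableAt_Gamma _ (add_one_ne_neg_natCast hx)).continuousAt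
  have h2 : ContinuousAt Complex.Gamma (g + 1) :=
    (Complex.differentiableAt_Gamma _ (add_one_ne_neg_natCast hg)).continuousAt
  have h3 : Continuous fun s => (Complex.Gamma s)⁻¹ :=
    Complex.differentiable_one_div_Gamma.continuous
  refine ((h1.comp (f := fun p : ℂ × ℂ => p.1 + 1) (by fun_prop)).mul
    (h2.comp (f := fun p : ℂ × ℂ => p.2 + 1) (by fun_prop))).mul ?_
  exact (h3.comp (g := fun s => (Complex.Gamma s)⁻¹)
    (f := fun p : ℂ × ℂ => p.1 + p.2 + 2) (by fun_prop)).continuousAt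

theorem tendsto_preJacobi {α β : ℂ} (hα : α ∉ negInts) (hβ : β ∉ negInts) (p : ℂ[X]) :
    Tendsto (preJacobi (fun t => p.eval t)) (approach α β) (𝓝 (moment α β p)) := by
  have h : Tendsto (fun q : ℂ × ℂ => moment q.1 q.2 p) (𝓝 (α, β)) (𝓝 (moment α β p)) := by
    unfold moment
    refine tendsto_finsetSum _ fun i _ => tendsto_const_nhds.mul ?_
    have := continuousAt_betaMoment (add_natCast_notMem_negInts hα i) hβ
    exact ContinuousAt.comp (g := fun p : ℂ × ℂ => betaMoment p.1 p.2)
      (f := fun q : ℂ × ℂ => (q.1 + i, q.2)) (x := (α, β)) this (by fun_prop)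
  refine (h.mono_left nhdsWithin_le_nhds).congr' ?_
  filter_upwards [self_mem_nhdsWithin] with q hq
  exact (preJacobi_polynomial p hq.1 hq.2).symm

/-- Needed for `limUnder` to return the limit; the integers are countable, so their complement is
dense. -/
instance approach_neBot (α β : ℂ) : (approach α β).NeBot := by
  have h : Dense {z : ℂ | ∀ k : ℤ, z ≠ k} := by
    convert! (Set.countable_range (fun k : ℤ => (k : ℂ))).dense_compl ℂ using 1
    ext z
    simp [eq_comm]
  exact mem_closure_iff_nhdsWithin_neBot.1 ((h.prod h) (α, β))

theorem jacobiIntegral_polynomial {α β : ℂ} (hα : α ∉ negInts) (hβ : β ∉ negInts) (p : ℂ[X]) :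
    jacobiIntegral α β (fun t => p.eval t) = moment α β p :=
  (tendsto_preJacobi hα hβ p).limUnder_eq

theorem moment_eq_sum (x g : ℂ) (p : ℂ[X]) :
    moment x g p = p.sum fun i a => a * betaMoment (x + i) g := by
  rw [moment, sum_over_range _ (fun n => by simp)]

theorem moment_of_natDegree_le (x g : ℂ) {p : ℂ[X]} {D : ℕ} (h : p.natDegree ≤ D) :
    moment x g p = ∑ i ∈ Finset.range (D + 1), p.coeff i * betaMoment (x + i) g := by
  rw [moment_eq_sum, sum_over_range' _ (fun n => by simp) _ (Nat.lt_succ_of_le h)]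

theorem moment_add (x g : ℂ) (p q : ℂ[X]) : moment x g (p + q) = moment x g p + moment x g q := by
  simp only [moment_eq_sum]
  exact sum_add_index _ _ _ (fun i => by simp) (fun i a b => by ring)

theorem moment_monomial (x g : ℂ) (i : ℕ) (a : ℂ) :
    moment x g (monomial i a) = a * betaMoment (x + i) g := by
  rw [moment_eq_sum, sum_monomial_index _ _ (by simp)]

theorem moment_C_mul (x g c : ℂ) (p : ℂ[X]) : moment x g (C c * p) = c * moment x g p := by
  induction p using Polynomial.induction_on' with
  | add p q hp hq => rw [mul_add, moment_add, moment_add, hp, hq]; ring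
  | monomial i a => rw [C_mul_monomial, moment_monomial, moment_monomial]; ring

theorem moment_mul_X_pow (x g : ℂ) (p : ℂ[X]) (k : ℕ) :
    moment x g (p * X ^ k) = moment (x + k) g p := by
  induction p using Polynomial.induction_on' with
  | add p q hp hq => rw [add_mul, moment_add, moment_add, hp, hq]
  | monomial i a =>
    rw [monomial_mul_X_pow, moment_monomial, moment_monomial]
    push_cast
    rw [add_assoc, add_comm (i : ℂ)]

/-! ### Integration by parts and the Rodrigues operators -/

/-- The polynomial `q` with `d/dt (t^(c+1) (1-t)^(g+1) p) = t^c (1-t)^g q`. -/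
noncomputable def jacobiStep (c g : ℂ) (p : ℂ[X]) : ℂ[X] :=
  C (c + 1) * ((1 - X) * p) - C (g + 1) * (X * p) + X * (1 - X) * derivative p

theorem jacobiStep_add (c g : ℂ) (p q : ℂ[X]) :
    jacobiStep c g (p + q) = jacobiStep c g p + jacobiStep c g q := by
  simp only [jacobiStep, derivative_add]; ring

theorem jacobiStep_monomial (c g : ℂ) (i : ℕ) (a : ℂ) :
    jacobiStep c g (monomial i a) =
      monomial i (a * (c + 1 + i)) + monomial (i + 1) (-(a * (c + g + 2 + i))) := by
  have h : X * derivative (monomial i a) = C (i : ℂ) * monomial i a := by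
    cases i with
    | zero => simp
    | succ i => rw [derivative_monomial, Nat.add_sub_cancel, X_mul_monomial, C_mul_monomial, mul_comm]
  have h2 : jacobiStep c g (monomial i a) = C (c + 1 + i) * monomial i a -
      C (c + g + 2 + i) * (X * monomial i a) := by
    rw [jacobiStep, show X * (1 - X) * derivative (monomial i a) =
      (1 - X) * (X * derivative (monomial i a)) by ring, h]
    simp only [C_add, C_1, C_ofNat]
    ring
  rw [h2, X_mul_monomial, C_mul_monomial, C_mul_monomial, sub_eq_add_neg, ← monomial_neg]
  congr 2 <;> ring

theorem add_one_ne_zero_of_notMem {x : ℂ} (hx : x ∉ negInts) : x + 1 ≠ 0 := by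
  simpa using add_one_ne_neg_natCast hx 0

/-- Formally, this integrates `t^(x-c)` against `d(t^(c+1) (1-t)^(g+1) p)` by parts. As the
integrals may diverge, it is instead verified on monomials from the two Beta recurrences. -/
theorem moment_jacobiStep {x g : ℂ} (hx : x ∉ negInts) (hg : g ∉ negInts) (c : ℂ) (p : ℂ[X]) :
    moment x g (jacobiStep c g p) = (c - x) * moment x (g + 1) p := by
  induction p using Polynomial.induction_on' with
  | add p q hp hq => rw [jacobiStep_add, moment_add, moment_add, hp, hq]; ring
  | monomial i a =>
    have hxi := add_one_ne_zero_of_notMem (add_natCast_notMem_negInts hx i)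
    have h1 := betaMoment_add_one hxi (add_one_ne_zero_of_notMem hg)
    have h2 := betaMoment_recurrence hxi g
    rw [jacobiStep_monomial, moment_add, moment_monomial, moment_monomial, moment_monomial]
    push_cast
    rw [← add_assoc]
    linear_combination a * h2 + a * (c - x) * h1

theorem natDegree_jacobiStep_le (c g : ℂ) (p : ℂ[X]) :
    (jacobiStep c g p).natDegree ≤ p.natDegree + 1 := by
  have h1 : ((1 : ℂ[X]) - X).natDegree ≤ 1 :=
    (natDegree_sub_le _ _).trans (by simp)
  have ha : (C (c + 1) * ((1 - X) * p)).natDegree ≤ p.natDegree + 1 := by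
    refine (natDegree_C_mul_le _ _).trans (natDegree_mul_le.trans ?_); omega
  have hb : (C (g + 1) * (X * p)).natDegree ≤ p.natDegree + 1 := by
    refine (natDegree_C_mul_le _ _).trans (natDegree_mul_le.trans ?_)
    rw [natDegree_X]; omega
  have hc : (X * (1 - X) * derivative p).natDegree ≤ p.natDegree + 1 := by
    by_cases hp : p.natDegree = 0
    · rw [derivative_of_natDegree_zero hp]; simp
    · have hd := natDegree_derivative_lt hp
      refine natDegree_mul_le.trans ?_
      have : (X * ((1 : ℂ[X]) - X)).natDegree ≤ 1 + 1 :=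
        natDegree_mul_le.trans (Nat.add_le_add natDegree_X_le h1)
      omega
  exact natDegree_add_le_of_le (natDegree_sub_le_of_le ha hb) hc |>.trans (by simp)

theorem eval_zero_jacobiStep (c g : ℂ) (p : ℂ[X]) :
    (jacobiStep c g p).eval 0 = (c + 1) * p.eval 0 := by
  simp [jacobiStep]

/-- The plane cut along `(-∞, 0]` and `[1, ∞)`. -/
def cutPlane : Set ℂ := {t | t ∈ Complex.slitPlane ∧ 1 - t ∈ Complex.slitPlane}

theorem isOpen_cutPlane : IsOpen cutPlane :=
  Complex.isOpen_slitPlane.inter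
    (Complex.isOpen_slitPlane.preimage (continuous_const.sub continuous_id))

theorem deriv_jacobi_weight (c g : ℂ) (p : ℂ[X]) {t : ℂ} (ht : t ∈ cutPlane) :
    deriv (fun s => s ^ (c + 1) * ((1 - s) ^ (g + 1) * p.eval s)) t =
      t ^ c * ((1 - t) ^ g * (jacobiStep c g p).eval t) := by
  have h0 := Complex.slitPlane_ne_zero ht.1
  have h1 := Complex.slitPlane_ne_zero ht.2
  have d1 := (hasDerivAt_id t).cpow_const (c := c + 1) ht.1
  have d2 := ((hasDerivAt_id t).const_sub 1).cpow_const (c := g + 1) ht.2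
  have := (d1.mul (d2.mul (p.hasDerivAt t))).deriv
  refine (Eq.trans ?_ this).trans ?_
  · rfl
  · simp only [id, add_sub_cancel_right, Pi.mul_apply]
    rw [Complex.cpow_add _ _ h0, Complex.cpow_add _ _ h1, Complex.cpow_one, Complex.cpow_one]
    simp only [jacobiStep, eval_add, eval_sub, eval_mul, eval_C, eval_X, eval_one]
    ring

theorem exists_iteratedDeriv_jacobi_weight (a g : ℂ) (k : ℕ) (p : ℂ[X]) : ∃ q : ℂ[X],
    (∀ t ∈ cutPlane, iteratedDeriv k
      (fun s => s ^ ((k : ℂ) + a) * ((1 - s) ^ (g + k) * p.eval s)) t =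
        t ^ a * ((1 - t) ^ g * q.eval t)) ∧
    q.natDegree ≤ p.natDegree + k ∧
    (a ∉ negInts → p.eval 0 ≠ 0 → q.eval 0 ≠ 0) ∧
    ∀ x ∉ negInts, g ∉ negInts →
      moment x g q = (∏ i ∈ Finset.range k, (a + i - x)) * moment x (g + k) p := by
  induction k generalizing p with
  | zero => exact ⟨p, by simp, by simp, by simp, by simp⟩
  | succ k ih =>
    -- The innermost derivative is taken first, where the exponents are `k + a + 1` and `g + k + 1`.
    obtain ⟨q, h1, h2, h3, h4⟩ := ih (jacobiStep (k + a) (g + k) p)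
    refine ⟨q, fun t ht => ?_, ?_, fun ha hp => h3 ha ?_, fun x hx hg => ?_⟩
    · rw [← h1 t ht, iteratedDeriv_succ']
      refine Filter.EventuallyEq.iteratedDeriv_eq _ ?_
      filter_upwards [isOpen_cutPlane.mem_nhds ht] with s hs
      rw [← deriv_jacobi_weight _ _ _ hs]
      push_cast
      rw [show (k : ℂ) + 1 + a = k + a + 1 by ring, add_assoc g]
    · have := natDegree_jacobiStep_le (k + a) (g + k) p
      omega
    · rw [eval_zero_jacobiStep]
      refine mul_ne_zero ?_ hp
      rw [add_comm (k : ℂ) a]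
      exact add_one_ne_zero_of_notMem (add_natCast_notMem_negInts ha k)
    · rw [h4 x hx hg, moment_jacobiStep hx (add_natCast_notMem_negInts hg k), Finset.prod_range_succ]
      push_cast
      rw [← add_assoc g]; ring

/-- Induction peels off the outermost operator; the inner ones form the same expression with `g`
replaced by `g + n 0`, which is why `g` is general. -/
theorem exists_polynomial_foldr_rodriguesOp (m : ℕ) (α : Fin m → ℂ) (n : Fin m → ℕ) (g : ℂ) :
    ∃ P : ℂ[X],
    (∀ t ∈ cutPlane, Fin.foldr m (fun j f => rodriguesOp (α j) (n j) f)
      (fun s => (1 - s) ^ (((∑ j, n j : ℕ) : ℂ) + g)) t = (1 - t) ^ g * P.eval t) ∧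
    P.natDegree ≤ ∑ j, n j ∧
    ((∀ j, α j ∉ negInts) → P.eval 0 ≠ 0) ∧
    ∀ x ∉ negInts, g ∉ negInts → ∃ b,
      moment x g P = (∏ j, ∏ i ∈ Finset.range (n j), (α j + i - x)) * b := by
  induction m generalizing g with
  | zero => exact ⟨1, by simp, by simp, by simp, fun x _ _ => ⟨moment x g 1, by simp⟩⟩
  | succ m ih =>
    obtain ⟨P, h1, h2, h3, h4⟩ := ih (fun j => α j.succ) (fun j => n j.succ) (g + n 0)
    obtain ⟨q, e1, e2, e3, e4⟩ := exists_iteratedDeriv_jacobi_weight (α 0) g (n 0) P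
    refine ⟨q, fun t ht => ?_, ?_, fun ha => e3 (ha 0) (h3 fun j => ha _), fun x hx hg => ?_⟩
    · rw [Fin.foldr_succ, rodriguesOp]
      have : iteratedDeriv (n 0) (fun s => s ^ ((n 0 : ℂ) + α 0) *
          Fin.foldr m (fun j f => rodriguesOp (α j.succ) (n j.succ) f)
            (fun s => (1 - s) ^ (((∑ j, n j : ℕ) : ℂ) + g)) s) t =
          t ^ α 0 * ((1 - t) ^ g * q.eval t) := by
        rw [← e1 t ht]
        refine Filter.EventuallyEq.iteratedDeriv_eq _ ?_
        filter_upwards [isOpen_cutPlane.mem_nhds ht] with s hs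
        rw [← h1 s hs, Fin.sum_univ_succ]
        push_cast
        rw [show (n 0 : ℂ) + ∑ j : Fin m, (n j.succ : ℂ) + g =
          ∑ j : Fin m, (n j.succ : ℂ) + (g + n 0) by ring]
      rw [this, ← mul_assoc, Complex.cpow_neg,
        inv_mul_cancel₀ ((Complex.cpow_ne_zero_iff).2 (Or.inl (Complex.slitPlane_ne_zero ht.1))),
        one_mul]
    · rw [Fin.sum_univ_succ]; omega
    · obtain ⟨b, hb⟩ := h4 x hx (add_natCast_notMem_negInts hg _)
      exact ⟨b, by rw [e4 x hx hg, hb, Fin.prod_univ_succ, mul_assoc]⟩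

/-! ### Mellin transform and perfectness -/

/-- The polynomial which, up to a Gamma factor, is the Mellin transform
`x ↦ ∫ p(t) t^x (1-t)^g dt` of `p`, a polynomial of degree at most `D`. -/
noncomputable def mellinPolynomial (g : ℂ) (D : ℕ) (p : ℂ[X]) : ℂ[X] :=
  ∑ i ∈ Finset.range (D + 1), C (p.coeff i) *
    ((∏ l ∈ Finset.range i, (X + C (1 + l : ℂ))) *
      ∏ l ∈ Finset.range (D - i), (X + C (g + 2 + i + l)))

theorem Gamma_add_natCast {x : ℂ} (hx : x ∉ negInts) (i : ℕ) :
    Complex.Gamma (x + i + 1) =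
      (∏ l ∈ Finset.range i, (x + (1 + l))) * Complex.Gamma (x + 1) := by
  induction i with
  | zero => simp
  | succ i ih =>
    have := Complex.Gamma_add_one _ (add_one_ne_zero_of_notMem (add_natCast_notMem_negInts hx i))
    push_cast
    rw [← add_assoc, this, ih, Finset.prod_range_succ]
    ring

theorem inv_Gamma_eq_prod (y : ℂ) (d : ℕ) : (Complex.Gamma y)⁻¹ =
    (∏ l ∈ Finset.range d, (y + l)) * (Complex.Gamma (y + d))⁻¹ := by
  induction d with
  | zero => simp
  | succ d ih =>
    rw [ih, Complex.one_div_Gamma_eq_self_mul_one_div_Gamma_add_one (y + d), Finset.prod_range_succ]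
    push_cast
    rw [← add_assoc]; ring

theorem moment_eq_mellinPolynomial {x : ℂ} (hx : x ∉ negInts) (g : ℂ) {D : ℕ} {p : ℂ[X]}
    (hp : p.natDegree ≤ D) :
    moment x g p = Complex.Gamma (x + 1) * Complex.Gamma (g + 1) *
      (Complex.Gamma (x + g + 2 + D))⁻¹ * (mellinPolynomial g D p).eval x := by
  rw [moment_of_natDegree_le x g hp, mellinPolynomial, eval_finsetSum, Finset.mul_sum]
  refine Finset.sum_congr rfl fun i hi => ?_
  have hi' : i ≤ D := Nat.lt_succ_iff.1 (Finset.mem_range.1 hi)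
  rw [betaMoment, Gamma_add_natCast hx, inv_Gamma_eq_prod _ (D - i),
    show x + i + g + 2 + (D - i : ℕ) = x + g + 2 + D by push_cast [hi']; ring]
  simp only [eval_mul, eval_C, eval_prod, eval_add, eval_X]
  rw [show ∏ l ∈ Finset.range (D - i), (x + i + g + 2 + (l : ℂ)) =
    ∏ l ∈ Finset.range (D - i), (x + (g + 2 + i + l)) from
      Finset.prod_congr rfl fun l _ => by ring]
  ring

theorem natDegree_prod_X_add_C_le (k : ℕ) (f : ℕ → ℂ) :
    (∏ l ∈ Finset.range k, (X + C (f l))).natDegree ≤ k := by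
  refine (natDegree_prod_le _ _).trans ?_
  simp

theorem natDegree_mellinPolynomial_le (g : ℂ) (D : ℕ) (p : ℂ[X]) :
    (mellinPolynomial g D p).natDegree ≤ D := by
  refine natDegree_sum_le_of_forall_le _ _ fun i hi => ?_
  have hi' : i ≤ D := Nat.lt_succ_iff.1 (Finset.mem_range.1 hi)
  refine (natDegree_C_mul_le _ _).trans (natDegree_mul_le.trans ?_)
  have h1 := natDegree_prod_X_add_C_le i (fun l => 1 + l)
  have h2 := natDegree_prod_X_add_C_le (D - i) (fun l => g + 2 + i + l)
  omega

/-- Evaluation at `x = -(1+l)` is triangular: terms with `i > l` contain a zero factor, and those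
with `i < l` are gone by induction. In the term `i = l` the factors are `k - l` with `k < l` and `g
+ 1 + k`, none of them zero. -/
theorem eq_zero_of_mellinPolynomial_eq_zero {g : ℂ} (hg : g ∉ negInts) {D : ℕ} {p : ℂ[X]}
    (hp : p.natDegree ≤ D) (h : mellinPolynomial g D p = 0) : p = 0 := by
  have key (l : ℕ) : l ≤ D → p.coeff l = 0 := by
    induction l using Nat.strong_induction_on with
    | _ l ih =>
      intro hl
      have h0 := congrArg (eval (-(1 + l : ℂ))) h
      rw [mellinPolynomial, eval_finsetSum, Finset.sum_eq_single l] at h0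
      · simp only [eval_mul, eval_C, eval_prod, eval_add, eval_X, eval_zero, mul_eq_zero,
          Finset.prod_eq_zero_iff] at h0
        rcases h0 with h0 | ⟨k, hk, h0⟩ | ⟨k, hk, h0⟩
        · exact h0
        · have : (k : ℂ) = l := by linear_combination h0
          have : k = l := by exact_mod_cast this
          simp [this] at hk
        · exact absurd h0 fun h0 => hg ⟨k, by linear_combination h0⟩
      · intro i hi hil
        rcases lt_or_gt_of_ne hil with hil | hil
        · simp [ih i hil (by omega)]
        · simp only [eval_mul, eval_C, eval_prod, eval_add, eval_X]
          rw [Finset.prod_eq_zero (Finset.mem_range.2 hil) (by ring)]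
          simp
      · intro hl'
        exact absurd (Finset.mem_range.2 (Nat.lt_succ_of_le hl)) hl'
  ext l
  rcases le_or_gt l D with hl | hl
  · simpa using key l hl
  · simpa using coeff_eq_zero_of_natDegree_lt (hp.trans_lt hl)

theorem eq_zero_of_moment_eq_zero {m : ℕ} {α : Fin m → ℂ} {β : ℂ}
    (hα : ∀ j, α j ∉ negInts) (hβ : β ∉ negInts) (hαβ : ∀ j, α j + β + 1 ∉ negInts)
    (hdiff : ∀ i j, i ≠ j → ∀ k : ℤ, α i - α j ≠ k) {n : Fin m → ℕ} {p : ℂ[X]}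
    (hp : p.natDegree < ∑ j, n j) (h : ∀ j, ∀ k < n j, moment (α j + k) β p = 0) : p = 0 := by
  -- Taking `D = p.natDegree` keeps the degree of the Mellin polynomial below the number `∑ j, n j`
  -- of its zeros.
  refine eq_zero_of_mellinPolynomial_eq_zero hβ le_rfl ?_
  refine eq_zero_of_natDegree_lt_card_of_eval_eq_zero _
    (f := fun x : Σ j, Fin (n j) => α x.1 + (x.2 : ℕ)) ?_ ?_ ?_
  · rintro ⟨i, k⟩ ⟨j, l⟩ hkl
    simp only at hkl
    obtain rfl : i = j := by
      by_contra hij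
      exact hdiff i j hij (l - k) (by push_cast; linear_combination hkl)
    have : ((k : ℕ) : ℂ) = (l : ℕ) := by linear_combination hkl
    have : k = l := Fin.ext (by exact_mod_cast this)
    rw [this]
  · rintro ⟨j, k⟩
    have hx := add_natCast_notMem_negInts (hα j) k
    have h0 := h j k k.2
    rw [moment_eq_mellinPolynomial hx β le_rfl] at h0
    refine (mul_eq_zero.1 h0).resolve_left (mul_ne_zero (mul_ne_zero ?_ ?_) (inv_ne_zero ?_))
    · exact Complex.Gamma_ne_zero (add_one_ne_neg_natCast hx)
    · exact Complex.Gamma_ne_zero (add_one_ne_neg_natCast hβ)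
    -- The condition on `α j + β + 1` enters here: it keeps `1/Γ` from vanishing and hiding the
    -- zero.
    · refine Complex.Gamma_ne_zero fun r hr => ?_
      exact add_one_ne_neg_natCast (add_natCast_notMem_negInts (hαβ j) (k + p.natDegree)) r
        (by push_cast; linear_combination hr)
  · simpa using (natDegree_mellinPolynomial_le β _ p).trans_lt hp

theorem isTypeII_iff {m : ℕ} {α : Fin m → ℂ} {β : ℂ}
    (hα : ∀ j, α j ∉ negInts) (hβ : β ∉ negInts) (n : Fin m → ℕ) (p : ℂ[X]) :
    IsTypeII (fun j => jacobiIntegral (α j) β) n p ↔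
      p ≠ 0 ∧ p.natDegree ≤ ∑ j, n j ∧ ∀ j, ∀ k < n j, moment (α j + k) β p = 0 := by
  have h (j : Fin m) (k : ℕ) :
      jacobiIntegral (α j) β (fun t => p.eval t * t ^ k) = moment (α j + k) β p := by
    rw [← moment_mul_X_pow, ← jacobiIntegral_polynomial (hα j) hβ]
    simp only [eval_mul, eval_pow, eval_X]
  simp only [IsTypeII, h]

end JacobiPineiro

theorem mainTheorem3 (m : ℕ) (α : Fin m → ℂ) (β : ℂ)
    (hα : ∀ j, α j ∉ JacobiPineiro.negInts)
    (hβ : β ∉ JacobiPineiro.negInts)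
    (hαβ : ∀ j, α j + β + 1 ∉ JacobiPineiro.negInts)
    (hdiff : ∀ i j, i ≠ j → ∀ k : ℤ, α i - α j ≠ k) :
    -- the limits that define the measures exist on all polynomials
    (∀ j, ∀ h : ℂ[X],
      Tendsto (JacobiPineiro.preJacobi (fun t => h.eval t)) (JacobiPineiro.approach (α j) β)
        (𝓝 (JacobiPineiro.jacobiIntegral (α j) β (fun t => h.eval t)))) ∧
    -- the system of measures is perfect
    JacobiPineiro.IsPerfect (fun j => JacobiPineiro.jacobiIntegral (α j) β) ∧
    -- the type II polynomial, unique up to a factor, is given by the Rodrigues formula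
    ∀ n : Fin m → ℕ, ∃ P : ℂ[X],
      (∀ t ∈ Complex.slitPlane, 1 - t ∈ Complex.slitPlane →
        P.eval t = JacobiPineiro.rodrigues α β n t) ∧
      JacobiPineiro.IsTypeII (fun j => JacobiPineiro.jacobiIntegral (α j) β) n P ∧
      ∀ q : ℂ[X], JacobiPineiro.IsTypeII (fun j => JacobiPineiro.jacobiIntegral (α j) β) n q →
        ∃ c : ℂ, c ≠ 0 ∧ q = C c * P := by
  have hperfect : JacobiPineiro.IsPerfect (fun j => JacobiPineiro.jacobiIntegral (α j) β) := by
    intro n p hp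
    obtain ⟨h0, h1, h2⟩ := (JacobiPineiro.isTypeII_iff hα hβ n p).1 hp
    refine h1.antisymm (not_lt.1 fun hlt => h0 ?_)
    exact JacobiPineiro.eq_zero_of_moment_eq_zero hα hβ hαβ hdiff hlt h2
  refine ⟨fun j h => ?_, hperfect, fun n => ?_⟩
  · rw [JacobiPineiro.jacobiIntegral_polynomial (hα j) hβ]
    exact JacobiPineiro.tendsto_preJacobi (hα j) hβ h
  obtain ⟨R, r1, r2, r3, r4⟩ := JacobiPineiro.exists_polynomial_foldr_rodriguesOp m α n β
  set F : ℂ := (∏ j, ((n j).factorial : ℂ))⁻¹ with hF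
  have hF0 : F ≠ 0 := inv_ne_zero
    (Finset.prod_ne_zero_iff.2 fun j _ => Nat.cast_ne_zero.2 (Nat.factorial_ne_zero _))
  have hR0 : R ≠ 0 := by
    rintro rfl
    simpa using r3 hα
  have hP : JacobiPineiro.IsTypeII (fun j => JacobiPineiro.jacobiIntegral (α j) β) n (C F * R) := by
    refine (JacobiPineiro.isTypeII_iff hα hβ n _).2
      ⟨mul_ne_zero (C_ne_zero.2 hF0) hR0, (natDegree_C_mul_le _ _).trans r2, fun j k hk => ?_⟩
    obtain ⟨b, hb⟩ := r4 _ (JacobiPineiro.add_natCast_notMem_negInts (hα j) k) hβ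
    -- The factor with `i = j`, `l = k` is zero.
    have h0 : ∏ i, ∏ l ∈ Finset.range (n i), (α i + l - (α j + k)) = 0 :=
      Finset.prod_eq_zero (Finset.mem_univ j)
        (Finset.prod_eq_zero (Finset.mem_range.2 hk) (sub_self _))
    rw [JacobiPineiro.moment_C_mul, hb, h0, zero_mul, mul_zero]
  refine ⟨C F * R, fun t ht ht' => ?_, hP, fun q hq => ?_⟩
  · rw [JacobiPineiro.rodrigues, r1 t ⟨ht, ht'⟩, eval_mul, eval_C, Complex.cpow_neg, mul_assoc,
      inv_mul_cancel_left₀ ((Complex.cpow_ne_zero_iff).2 (Or.inl (Complex.slitPlane_ne_zero ht')))]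
  · have dP := hperfect n _ hP
    have dq := hperfect n _ hq
    obtain ⟨P0, -, P2⟩ := (JacobiPineiro.isTypeII_iff hα hβ n _).1 hP
    obtain ⟨q0, -, q2⟩ := (JacobiPineiro.isTypeII_iff hα hβ n _).1 hq
    generalize C F * R = P at *
    have lP := leadingCoeff_ne_zero.2 P0
    have lq := leadingCoeff_ne_zero.2 q0
    refine ⟨q.leadingCoeff / P.leadingCoeff, div_ne_zero lq lP, ?_⟩
    set c := q.leadingCoeff / P.leadingCoeff with hc
    have hc0 : c ≠ 0 := div_ne_zero lq lP
    by_contra hne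
    have hsub : q - C c * P ≠ 0 := sub_ne_zero.2 hne
    -- By perfectness both polynomials have degree exactly `|n|`; cancelling leading terms leaves an
    -- orthogonal polynomial of smaller degree, which must be zero.
    have hdeg : (q - C c * P).degree < q.degree := by
      refine degree_sub_lt_left ?_ q0 ?_
      · rw [degree_C_mul hc0, degree_eq_natDegree P0, degree_eq_natDegree q0, dP, dq]
      · rw [leadingCoeff_mul, leadingCoeff_C, hc, div_mul_cancel₀ _ lP]
    have hnat := natDegree_lt_natDegree hsub hdeg
    rw [dq] at hnat
    refine hsub (JacobiPineiro.eq_zero_of_moment_eq_zero hα hβ hαβ hdiff hnat fun j k hk => ?_)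
    rw [sub_eq_add_neg, ← neg_mul, ← C_neg, JacobiPineiro.moment_add, JacobiPineiro.moment_C_mul,
      q2 j k hk, P2 j k hk, mul_zero, add_zero]
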